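/- Let $H$ be an infinite-dimensional separable complex Hilbert space, $\mathcal K(H)\subset\mathcal B(H)$ the compact operators, $\mathcal Q(H)=\mathcal B(H)/\mathcal K(H)$ the Calkin algebra and $\pi\colon\mathcal B(H)\to\mathcal Q(H)$ the quotient map. Let $\mathcal U$ be a nonprincipal ultrafilter on $\mathbb N$, let $\mathbb H$ be the Hausdorff completion of the space of weakly null sequences in $H$ with respect to the semi-inner product $\langle (x_n),(y_n)\rangle=\lim_{n,\mathcal U}\langle x_n,y_n\rangle$, and let $\gamma\colon\mathcal Q(H)\to\mathcal B(\mathbb H)$, $\gamma(\pi(T))[(x_n)]=[(Tx_n)]$, be the $\mathcal U$-Calkin representation. Let $\mathbb D=\{k2^{-m}\colon k\ge 1,\ m\ge 0\}$ be the set of positive dyadic rationals. Let $(q(t))_{t\in\mathbb D}\subset\mathcal Q(H)$ be a semigroup (that is, $q(s+t)=q(s)q(t)$) of normal elements which is a $C_0$-semigroup under $\gamma$: there is a $C_0$-semigroup $(T(t))_{t\ge 0}\subset\mathcal B(\mathbb H)$ with $T(t)=\gamma(q(t))$ for all $t\in\mathbb D$. (In particular, this covers every semigroup $(q(t))_{t\ge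 0}$ of normal elements of $\mathcal Q(H)$ such that $(\gamma(q(t)))_{t\ge 0}$ is a $C_0$-semigroup.) Let $\mathcal A_0$ be the commutative $C^*$-subalgebra of $\mathcal Q(H)$ generated by $1$ and all $q(2^{-n})$, $n=0,1,2,\ldots$, let $\Delta$ be its maximal ideal space, let $a\mapsto\widehat a\in C(\Delta)$ be the Gelfand transform of $\mathcal A_0$, let $\mathcal E=\pi^{-1}(\mathcal A_0)$, and let $\Gamma$ be the associated extension $$0\to\mathcal K(H)\to\mathcal E\xrightarrow{\ \theta\ }C(\Delta)\to 0,\qquad \theta(T)=\widehat{\pi(T)}.$$ Suppose that $\Gamma$ is the zero element $\Theta$ of $\mathrm{Ext}(\Delta)$, i.e. its Busby invariant $\tau=\pi\theta^{-1}\colon C(\Delta)\to\mathcal Q(H)$ satisfies $\tau=\pi(W)^*(\pi\circ\sigma)\pi(W)$ for some unitary $W\in\mathcal B(H)$ and some $*$-homomorphism $\sigma(g)=\bigoplus_{i} g(\xi_i)I_{H_i}$, where $(\xi_i)_{i\in\mathbb N}$ is dense in $\Delta$ and $H=\bigoplus_{i\in\mathbb N}H_i$ is an orthogonal decomposition into infinite-dimensional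 closed subspaces. If $\Delta$ has no isolated points, then there is a unital $*$-homomorphism $\rho\colon C(\Delta)\to\mathcal E$ with $\theta\rho=\mathrm{id}_{C(\Delta)}$ (a splitting), and for every such $\rho$ the operators $$Q(t)=\rho(\widehat{q(t)})\qquad(t\in\mathbb D)$$ form a semigroup in $\mathcal B(H)$ which lifts $(q(t))_{t\in\mathbb D}$, i.e. $\pi(Q(t))=q(t)$ for all $t\in\mathbb D$, which is SOT-continuous on $\mathbb D$, and which extends to a $C_0$-semigroup in $\mathcal B(H)$ defined on $[0,\infty)$. -/

import Mathlib

noncomputable section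

set_option linter.unusedSectionVars false

open Filter Topology
open scoped NNReal

namespace CalkinLift

section Calkin

variable (H : Type*) [NormedAddCommGroup H] [InnerProductSpace ℂ H] [CompleteSpace H]

/-- The ideal `K(H)` of compact operators in `B(H)`. -/
def compactIdeal : Ideal (H →L[ℂ] H) where
  carrier := {T | IsCompactOperator T}
  add_mem' ha hb := ha.add hb
  zero_mem' := isCompactOperator_zero
  smul_mem' c _ hx := hx.clm_comp c

variable {H} in
theorem mem_compactIdeal {T : H →L[ℂ] H} : T ∈ compactIdeal H ↔ IsCompactOperator T := Iff.rfl

instance : (compactIdeal H).IsTwoSided :=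
  ⟨fun b ha => IsCompactOperator.comp_clm ha b⟩

theorem isClosed_compactIdeal : IsClosed (compactIdeal H : Set (H →L[ℂ] H)) :=
  isClosed_setOfPred_isCompactOperator

variable {H} in
theorem exists_finiteDimensional_approx {K : H →L[ℂ] H} (hK : IsCompactOperator K) {ε : ℝ}
    (hε : 0 < ε) : ∃ V : Submodule ℂ H, ∃ _ : FiniteDimensional ℂ V,
      ‖(1 - V.starProjection) * K‖ ≤ ε := by
  have hc := (hK.isCompact_closure_image_closedBall (1 : ℝ)).totallyBounded
  obtain ⟨t, htf, ht⟩ := Metric.totallyBounded_iff.1 hc ε hε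
  refine ⟨Submodule.span ℂ t, FiniteDimensional.span_of_finite ℂ htf, ?_⟩
  have : FiniteDimensional ℂ (Submodule.span ℂ t) := FiniteDimensional.span_of_finite ℂ htf
  refine ContinuousLinearMap.opNorm_le_of_unit_norm hε.le fun x hx => ?_
  have hm := ht (subset_closure ⟨x, by simp [hx], rfl⟩)
  simp only [Set.mem_iUnion, Metric.mem_ball, dist_eq_norm] at hm
  obtain ⟨y, hy, hxy⟩ := hm
  have h1 : ((1 - (Submodule.span ℂ t).starProjection) * K) x
      = (1 - (Submodule.span ℂ t).starProjection) (K x - y) := by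
    have : (Submodule.span ℂ t).starProjection y = y :=
      Submodule.starProjection_eq_self_iff.2 (Submodule.subset_span hy)
    simp [this]
  rw [h1]
  have h2 : ‖(1 - (Submodule.span ℂ t).starProjection : H →L[ℂ] H)‖ ≤ 1 := by
    have := Submodule.starProjection_norm_le (Submodule.span ℂ t)ᗮ
    rwa [Submodule.starProjection_orthogonal] at this
  calc _ ≤ 1 * ‖K x - y‖ := ContinuousLinearMap.le_of_opNorm_le _ h2 _
    _ ≤ ε := by rw [one_mul]; exact hxy.le

variable {H} in
theorem isCompactOperator_starProjection (V : Submodule ℂ H) [FiniteDimensional ℂ V] :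
    IsCompactOperator V.starProjection := by
  have : ProperSpace V := FiniteDimensional.proper ℂ V
  have h : IsCompactOperator (V.subtypeL : V → H) :=
    isCompactOperator_of_locallyCompactSpace_rng V.subtypeL
  exact h.comp_clm V.orthogonalProjectionOnto

variable {H} in
theorem star_mem_compactIdeal {T : H →L[ℂ] H} (hT : T ∈ compactIdeal H) :
    star T ∈ compactIdeal H := by
  have key : ∀ ε > 0, ∃ S ∈ compactIdeal H, dist (star T) S < ε := by
    intro ε hε
    obtain ⟨V, hV, h⟩ := exists_finiteDimensional_approx hT (half_pos hε)
    refine ⟨star T * V.starProjection,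
      (compactIdeal H).mul_mem_left _ (isCompactOperator_starProjection V), ?_⟩
    have : star T - star T * V.starProjection = star ((1 - V.starProjection) * T) := by
      have hs : star V.starProjection = V.starProjection := (isSelfAdjoint_starProjection V).star_eq
      rw [star_mul, star_sub, star_one, hs, mul_sub, mul_one]
    rw [dist_eq_norm, this, norm_star]
    linarith
  have : star T ∈ closure (compactIdeal H : Set (H →L[ℂ] H)) := Metric.mem_closure_iff.2 key
  rwa [(isClosed_compactIdeal H).closure_eq] at this

/-- The Calkin algebra `Q(H) = B(H) / K(H)`. -/
def Calkin : Type _ := (H →L[ℂ] H) ⧸ compactIdeal H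

namespace Calkin

instance : Ring (Calkin H) := inferInstanceAs (Ring ((H →L[ℂ] H) ⧸ compactIdeal H))

instance : Algebra ℂ (Calkin H) := inferInstanceAs (Algebra ℂ ((H →L[ℂ] H) ⧸ compactIdeal H))

/-- The quotient map as an algebra homomorphism. -/
def mkAlg : (H →L[ℂ] H) →ₐ[ℂ] Calkin H := Ideal.Quotient.mkₐ ℂ (compactIdeal H)

theorem mkAlg_surjective : Function.Surjective (mkAlg H) := Ideal.Quotient.mkₐ_surjective _ _

variable {H} in
theorem mkAlg_eq_iff {S T : H →L[ℂ] H} : mkAlg H S = mkAlg H T ↔ S - T ∈ compactIdeal H :=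
  Ideal.Quotient.eq

instance : StarRing (Calkin H) where
  star := Quotient.map' (s₁ := Submodule.quotientRel (compactIdeal H))
    (s₂ := Submodule.quotientRel (compactIdeal H)) star (by
      intro a b h
      rw [Submodule.quotientRel_def] at h ⊢
      rw [← star_sub]
      exact star_mem_compactIdeal h)
  star_involutive a := by
    obtain ⟨a, rfl⟩ := mkAlg_surjective H a
    exact congrArg (mkAlg H) (star_star a)
  star_mul a b := by
    obtain ⟨a, rfl⟩ := mkAlg_surjective H a
    obtain ⟨b, rfl⟩ := mkAlg_surjective H b
    exact congrArg (mkAlg H) (star_mul a b)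
  star_add a b := by
    obtain ⟨a, rfl⟩ := mkAlg_surjective H a
    obtain ⟨b, rfl⟩ := mkAlg_surjective H b
    exact congrArg (mkAlg H) (star_add a b)

/-- The quotient map `π : B(H) → Q(H)`. -/
def mk : (H →L[ℂ] H) →⋆ₐ[ℂ] Calkin H where
  toAlgHom := mkAlg H
  map_star' _ := rfl

theorem mk_surjective : Function.Surjective (mk H) := mkAlg_surjective H

variable {H} in
theorem mk_eq_zero_iff {T : H →L[ℂ] H} : mk H T = 0 ↔ IsCompactOperator T :=
  Ideal.Quotient.eq_zero_iff_mem

instance : NormedAddCommGroup (Calkin H) :=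
  haveI := isClosed_compactIdeal H
  inferInstanceAs (NormedAddCommGroup ((H →L[ℂ] H) ⧸ compactIdeal H))

variable {H} in
theorem norm_mk_le (T : H →L[ℂ] H) : ‖mk H T‖ ≤ ‖T‖ :=
  Submodule.Quotient.norm_mk_le (compactIdeal H) T

variable {H} in
theorem exists_norm_lt (a : Calkin H) {ε : ℝ} (hε : 0 < ε) :
    ∃ T : H →L[ℂ] H, mk H T = a ∧ ‖T‖ < ‖a‖ + ε :=
  Submodule.Quotient.norm_mk_lt (S := compactIdeal H) a hε

instance : NormedRing (Calkin H) where
  __ := (inferInstance : Ring (Calkin H))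
  __ := (inferInstance : NormedAddCommGroup (Calkin H))
  norm_mul_le a b := by
    have key : ∀ ε > 0, ‖a * b‖ ≤ (‖a‖ + ε) * (‖b‖ + ε) := fun ε hε => by
      obtain ⟨S, hS, hS'⟩ := exists_norm_lt a hε
      obtain ⟨T, hT, hT'⟩ := exists_norm_lt b hε
      calc ‖a * b‖ = ‖mk H (S * T)‖ := by rw [map_mul, hS, hT]
        _ ≤ ‖S * T‖ := norm_mk_le _
        _ ≤ ‖S‖ * ‖T‖ := norm_mul_le _ _
        _ ≤ _ := by gcongr
    have hlim : Tendsto (fun ε : ℝ => (‖a‖ + ε) * (‖b‖ + ε)) (𝓝[>] 0) (𝓝 (‖a‖ * ‖b‖)) := by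
      have : Continuous fun ε : ℝ => (‖a‖ + ε) * (‖b‖ + ε) := by fun_prop
      simpa using (this.tendsto 0).mono_left nhdsWithin_le_nhds
    exact ge_of_tendsto hlim (eventually_nhdsWithin_of_forall fun ε hε => key ε hε)

instance : NormedAlgebra ℂ (Calkin H) where
  norm_smul_le c a :=
    norm_smul_le (β := (H →L[ℂ] H) ⧸ compactIdeal H) c a

instance : CompleteSpace (Calkin H) :=
  Submodule.Quotient.completeSpace (compactIdeal H)

instance : StarModule ℂ (Calkin H) where
  star_smul c a := by
    obtain ⟨a, rfl⟩ := mk_surjective H a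
    rw [← map_smul, ← map_star, ← map_star, star_smul, map_smul]

instance : CStarRing (Calkin H) where
  norm_mul_self_le a := by
    obtain ⟨T, rfl⟩ := mk_surjective H a
    have key : ∀ ε > 0, ‖mk H T‖ * ‖mk H T‖ ≤ ‖star (mk H T) * mk H T‖ + (ε + ε) := by
      intro ε hε
      obtain ⟨S, hS, hS'⟩ := exists_norm_lt (star (mk H T) * mk H T) hε
      have hK : star T * T - S ∈ compactIdeal H := by
        rw [← mkAlg_eq_iff]
        change mk H _ = mk H _
        rw [hS, map_mul, map_star]
      obtain ⟨V, hV, h⟩ := exists_finiteDimensional_approx (star_mem_compactIdeal hK) hε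
      have hs : star V.starProjection = V.starProjection := (isSelfAdjoint_starProjection V).star_eq
      set R : H →L[ℂ] H := 1 - V.starProjection with hR
      have hRs : star R = R := by rw [hR, star_sub, star_one, hs]
      have hRn : ‖R‖ ≤ 1 := by
        have := Submodule.starProjection_norm_le Vᗮ
        rwa [Submodule.starProjection_orthogonal] at this
      have hKR : ‖(star T * T - S) * R‖ ≤ ε := by
        rw [← norm_star, star_mul, hRs]; exact h
      have hTR : mk H T = mk H (T * R) := by
        refine mkAlg_eq_iff.2 ?_
        have : T - T * R = T * V.starProjection := by rw [hR, mul_sub, mul_one]; abel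
        rw [this]
        exact (compactIdeal H).mul_mem_left _ (isCompactOperator_starProjection V)
      have hRb : ∀ X : H →L[ℂ] H, ‖R * X‖ ≤ ‖X‖ := fun X =>
        (norm_mul_le _ _).trans (mul_le_of_le_one_left (norm_nonneg _) hRn)
      have hRb' : ∀ X : H →L[ℂ] H, ‖X * R‖ ≤ ‖X‖ := fun X =>
        (norm_mul_le _ _).trans (mul_le_of_le_one_right (norm_nonneg _) hRn)
      calc ‖mk H T‖ * ‖mk H T‖ ≤ ‖T * R‖ * ‖T * R‖ := by
            rw [hTR]; gcongr <;> exact norm_mk_le _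
        _ = ‖star (T * R) * (T * R)‖ := CStarRing.norm_star_mul_self.symm
        _ = ‖R * (S * R) + R * ((star T * T - S) * R)‖ := by
            rw [star_mul, hRs]; congr 1; noncomm_ring
        _ ≤ ‖R * (S * R)‖ + ‖R * ((star T * T - S) * R)‖ := norm_add_le _ _
        _ ≤ ‖S‖ + ε := add_le_add ((hRb _).trans (hRb' _)) ((hRb _).trans hKR)
        _ ≤ _ := by linarith
    refine le_of_forall_pos_le_add fun ε hε => ?_
    have := key (ε / 2) (half_pos hε)
    linarith

/-- The Calkin algebra is a C⋆-algebra. -/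
instance : CStarAlgebra (Calkin H) where

end Calkin
end Calkin

section Representation

variable (H : Type*) [NormedAddCommGroup H] [InnerProductSpace ℂ H] [CompleteSpace H]

/-- The space of weakly null sequences in `H`. -/
def weaklyNull : Submodule ℂ (ℕ → H) where
  carrier := {x | ∀ y : H, Tendsto (fun n => inner ℂ y (x n)) atTop (𝓝 0)}
  add_mem' ha hb y := by simpa [inner_add_right] using (ha y).add (hb y)
  zero_mem' y := by simp
  smul_mem' c x hx y := by simpa [inner_smul_right] using (hx y).const_mul c

variable {H} in
theorem weaklyNull_bounded {x : ℕ → H} (hx : x ∈ weaklyNull H) : ∃ C, ∀ n, ‖x n‖ ≤ C := by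
  obtain ⟨C, hC⟩ := banach_steinhaus (g := fun n => innerSL ℂ (x n)) (fun y => by
    obtain ⟨C, hC⟩ := (hx y).norm.bddAbove_range
    refine ⟨C, fun n => ?_⟩
    rw [innerSL_apply_apply, ← inner_conj_symm, RCLike.norm_conj]
    exact hC ⟨n, rfl⟩)
  exact ⟨C, fun n => by simpa using hC n⟩

/-- The space of weakly null sequences, to be equipped with the semi-inner product
`⟪x, y⟫ = LIM_{n, U} ⟪x n, y n⟫`. -/
def PreCalkinSpace (_U : Ultrafilter ℕ) : Type _ := weaklyNull H

variable (U : Ultrafilter ℕ)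

instance : AddCommGroup (PreCalkinSpace H U) := inferInstanceAs (AddCommGroup (weaklyNull H))

instance : Module ℂ (PreCalkinSpace H U) := inferInstanceAs (Module ℂ (weaklyNull H))

variable {H U} in
/-- The limit along the ultrafilter `U` of the inner products; it exists as weakly null sequences
are bounded. -/
theorem tendsto_preInner (x y : PreCalkinSpace H U) :
    Tendsto (fun n => inner ℂ (x.1 n) (y.1 n)) (U : Filter ℕ)
      (𝓝 (limUnder (U : Filter ℕ) fun n => inner ℂ (x.1 n) (y.1 n))) := by
  refine tendsto_nhds_limUnder ?_
  obtain ⟨C, hC⟩ := weaklyNull_bounded x.2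
  obtain ⟨D, hD⟩ := weaklyNull_bounded y.2
  have hb : ∀ n, inner ℂ (x.1 n) (y.1 n) ∈ Metric.closedBall (0 : ℂ) (C * D) := fun n => by
    rw [mem_closedBall_zero_iff]
    exact (norm_inner_le_norm _ _).trans (mul_le_mul (hC n) (hD n) (norm_nonneg _)
      ((norm_nonneg _).trans (hC n)))
  obtain ⟨z, -, hz⟩ := (isCompact_closedBall (0 : ℂ) (C * D)).ultrafilter_le_nhds
    (U.map fun n => inner ℂ (x.1 n) (y.1 n))
    (le_principal_iff.2 (Filter.mem_map.2 (Filter.univ_mem' hb)))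
  exact ⟨z, hz⟩

/-- The semi-inner product `⟪x, y⟫ = LIM_{n, U} ⟪x n, y n⟫`. -/
abbrev preCore : PreInnerProductSpace.Core ℂ (PreCalkinSpace H U) where
  inner x y := limUnder (U : Filter ℕ) fun n => inner ℂ (x.1 n) (y.1 n)
  conj_inner_symm x y := by
    refine tendsto_nhds_unique ?_ (tendsto_preInner x y)
    refine (((RCLike.continuous_conj (K := ℂ)).tendsto _).comp (tendsto_preInner y x)).congr
      fun n => ?_
    exact inner_conj_symm _ _
  re_inner_nonneg x :=
    ge_of_tendsto' ((RCLike.continuous_re.tendsto _).comp (tendsto_preInner x x))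
      fun n => inner_self_nonneg
  add_left x y z := by
    refine tendsto_nhds_unique (tendsto_preInner (x + y) z) ?_
    refine ((tendsto_preInner x z).add (tendsto_preInner y z)).congr fun n => ?_
    exact (inner_add_left _ _ _).symm
  smul_left x y r := by
    refine tendsto_nhds_unique (tendsto_preInner (r • x) y) ?_
    refine ((tendsto_preInner x y).const_mul _).congr fun n => ?_
    exact (inner_smul_left _ _ _).symm

instance : SeminormedAddCommGroup (PreCalkinSpace H U) :=
  letI := preCore H U
  InnerProductSpace.Core.toSeminormedAddCommGroup (𝕜 := ℂ)

instance : InnerProductSpace ℂ (PreCalkinSpace H U) := InnerProductSpace.ofCore (preCore H U)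

variable {H U} in
theorem tendsto_inner (x y : PreCalkinSpace H U) :
    Tendsto (fun n => inner ℂ (x.1 n) (y.1 n)) (U : Filter ℕ) (𝓝 (inner ℂ x y)) :=
  tendsto_preInner x y

variable {H U} in
theorem tendsto_norm_sq (x : PreCalkinSpace H U) :
    Tendsto (fun n => ‖x.1 n‖ ^ 2) (U : Filter ℕ) (𝓝 (‖x‖ ^ 2)) := by
  have := (RCLike.continuous_re.tendsto _).comp (tendsto_inner x x)
  simpa only [Function.comp_def, inner_self_eq_norm_sq] using this

/-- The Hilbert space `ℍ` of the Calkin representation: the Hausdorff completion of the space of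
weakly null sequences for the semi-inner product `LIM_{n, U} ⟪x n, y n⟫`. In particular sequences
whose difference tends to zero in norm are identified. -/
abbrev CalkinSpace : Type _ := UniformSpace.Completion (PreCalkinSpace H U)

variable {H} in
/-- The action `(x n) ↦ (T x n)` of `T ∈ B(H)` on weakly null sequences. -/
def preRep (T : H →L[ℂ] H) : PreCalkinSpace H U →L[ℂ] PreCalkinSpace H U :=
  LinearMap.mkContinuous
    { toFun := fun x => ⟨fun n => T (x.1 n), fun y => by
        simpa only [ContinuousLinearMap.adjoint_inner_left] using
          x.2 (ContinuousLinearMap.adjoint T y)⟩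
      map_add' := fun x y => Subtype.ext (funext fun n => T.map_add (x.1 n) (y.1 n))
      map_smul' := fun c x => Subtype.ext (funext fun n => T.map_smul c (x.1 n)) }
    ‖T‖ fun x => by
      refine (pow_le_pow_iff_left₀ (norm_nonneg _) (by positivity) two_ne_zero).1 ?_
      rw [mul_pow]
      refine le_of_tendsto_of_tendsto' (tendsto_norm_sq _)
        ((tendsto_norm_sq x).const_mul (‖T‖ ^ 2)) fun n => ?_
      rw [← mul_pow]
      exact pow_le_pow_left₀ (norm_nonneg _) (T.le_opNorm _) 2

variable {H} in
@[simp] theorem preRep_apply (T : H →L[ℂ] H) (x : PreCalkinSpace H U) (n : ℕ) :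
    (preRep U T x).1 n = T (x.1 n) := rfl

/-- The representation `Φ` of `B(H)` on `ℍ`. -/
def calkinPhi : (H →L[ℂ] H) →⋆ₐ[ℂ] (CalkinSpace H U →L[ℂ] CalkinSpace H U) where
  toFun T := (preRep U T).completion
  map_one' := by
    refine ContinuousLinearMap.ext fun x => ?_
    induction x using UniformSpace.Completion.induction_on with
    | hp => exact isClosed_eq (ContinuousLinearMap.continuous _) (ContinuousLinearMap.continuous _)
    | ih x => exact ContinuousLinearMap.completion_apply_coe _ _
  map_mul' S T := by
    refine ContinuousLinearMap.ext fun x => ?_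
    induction x using UniformSpace.Completion.induction_on with
    | hp => exact isClosed_eq (ContinuousLinearMap.continuous _) (ContinuousLinearMap.continuous _)
    | ih x =>
      simp only [mul_apply_eq_comp, ContinuousLinearMap.completion_apply_coe]
      rfl
  map_zero' := by
    refine ContinuousLinearMap.ext fun x => ?_
    induction x using UniformSpace.Completion.induction_on with
    | hp => exact isClosed_eq (ContinuousLinearMap.continuous _) (ContinuousLinearMap.continuous _)
    | ih x => exact ContinuousLinearMap.completion_apply_coe _ _
  map_add' S T := by
    refine ContinuousLinearMap.ext fun x => ?_
    induction x using UniformSpace.Completion.induction_on with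
    | hp => exact isClosed_eq (ContinuousLinearMap.continuous _) (ContinuousLinearMap.continuous _)
    | ih x =>
      simp only [add_apply, ContinuousLinearMap.completion_apply_coe,
        ← UniformSpace.Completion.coe_add]
      rfl
  commutes' c := by
    refine ContinuousLinearMap.ext fun x => ?_
    induction x using UniformSpace.Completion.induction_on with
    | hp => exact isClosed_eq (ContinuousLinearMap.continuous _) (ContinuousLinearMap.continuous _)
    | ih x =>
      simp only [ContinuousLinearMap.completion_apply_coe, ContinuousLinearMap.algebraMap_apply,
        ← UniformSpace.Completion.coe_smul]
      rfl
  map_star' T := by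
    rw [ContinuousLinearMap.star_eq_adjoint, ContinuousLinearMap.star_eq_adjoint,
      ContinuousLinearMap.eq_adjoint_iff]
    intro x y
    induction x, y using UniformSpace.Completion.induction_on₂ with
    | hp => exact isClosed_eq (by fun_prop) (by fun_prop)
    | ih x y =>
      simp only [ContinuousLinearMap.completion_apply_coe, UniformSpace.Completion.inner_coe]
      refine tendsto_nhds_unique (tendsto_inner _ _) ((tendsto_inner _ _).congr fun n => ?_)
      exact (ContinuousLinearMap.adjoint_inner_left T _ _).symm

variable {H U} in
@[simp] theorem calkinPhi_coe (T : H →L[ℂ] H) (x : PreCalkinSpace H U) :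
    calkinPhi H U T (x : CalkinSpace H U) = (preRep U T x : CalkinSpace H U) :=
  ContinuousLinearMap.completion_apply_coe _ _

variable {H} in
/-- A compact operator maps weakly null sequences to norm null sequences. -/
theorem tendsto_of_isCompactOperator {T : H →L[ℂ] H} (hT : IsCompactOperator T) {x : ℕ → H}
    (hx : x ∈ weaklyNull H) : Tendsto (fun n => T (x n)) atTop (𝓝 0) := by
  obtain ⟨C, hC⟩ := weaklyNull_bounded hx
  refine (hT.isCompact_closure_image_closedBall C).tendsto_nhds_of_unique_mapClusterPt
    (Eventually.of_forall fun n => subset_closure ⟨x n, by simpa using hC n, rfl⟩) ?_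
  intro y _ hy
  have h1 : MapClusterPt (inner ℂ y y) atTop (fun n => inner ℂ y (T (x n))) :=
    MapClusterPt.continuousAt_comp (f := fun z => inner ℂ y z) (by fun_prop) hy
  have h2 : Tendsto (fun n => inner ℂ y (T (x n))) atTop (𝓝 (0 : ℂ)) := by
    simpa only [ContinuousLinearMap.adjoint_inner_left] using hx (ContinuousLinearMap.adjoint T y)
  have h3 : inner ℂ y y = (0 : ℂ) := by
    have := (h1.clusterPt.mono h2)
    exact eq_of_nhds_neBot this
  exact inner_self_eq_zero.1 h3

variable {H U} in
theorem calkinPhi_eq_zero (hU : (U : Filter ℕ) ≤ cofinite) {T : H →L[ℂ] H}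
    (hT : IsCompactOperator T) : calkinPhi H U T = 0 := by
  rw [Nat.cofinite_eq_atTop] at hU
  refine ContinuousLinearMap.ext fun x => ?_
  induction x using UniformSpace.Completion.induction_on with
  | hp => exact isClosed_eq (ContinuousLinearMap.continuous _) (ContinuousLinearMap.continuous _)
  | ih x =>
    rw [calkinPhi_coe, zero_apply, ← norm_eq_zero, UniformSpace.Completion.norm_coe]
    have h0 : Tendsto (fun n => ‖T (x.1 n)‖ ^ 2) (U : Filter ℕ) (𝓝 0) := by
      simpa using ((tendsto_of_isCompactOperator hT x.2).mono_left hU).norm.pow 2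
    have := tendsto_nhds_unique (tendsto_norm_sq (preRep U T x)) h0
    simpa using this

variable {U} in
/-- The Calkin representation `γ : Q(H) → B(ℍ)` given by a nonprincipal ultrafilter `U`,
`γ (π T) = Φ T`. -/
def calkinRep (hU : (U : Filter ℕ) ≤ cofinite) :
    Calkin H →⋆ₐ[ℂ] (CalkinSpace H U →L[ℂ] CalkinSpace H U) where
  toAlgHom := Ideal.Quotient.liftₐ (compactIdeal H) (calkinPhi H U : _ →ₐ[ℂ] _)
    fun _ hT => calkinPhi_eq_zero hU hT
  map_star' a := by
    obtain ⟨a, rfl⟩ := Calkin.mk_surjective H a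
    exact map_star (calkinPhi H U) a

variable {H U} in
theorem calkinRep_mk (hU : (U : Filter ℕ) ≤ cofinite) (T : H →L[ℂ] H) :
    calkinRep H hU (Calkin.mk H T) = calkinPhi H U T := rfl

end Representation
section Semigroups

/-- A `C₀`-semigroup of bounded operators on a Banach space. -/
structure C0Semigroup (E : Type*) [NormedAddCommGroup E] [NormedSpace ℂ E] where
  toFun : ℝ≥0 → E →L[ℂ] E
  map_zero : toFun 0 = 1
  map_add : ∀ s t, toFun (s + t) = toFun s * toFun t
  continuous_apply : ∀ x : E, Continuous fun t => toFun t x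

/-- The set of positive dyadic rational numbers. -/
def PosDyadic : Type := {t : ℝ≥0 // ∃ k m : ℕ, 0 < k ∧ t = k / 2 ^ m}

namespace PosDyadic

instance : TopologicalSpace PosDyadic :=
  inferInstanceAs (TopologicalSpace {t : ℝ≥0 // ∃ k m : ℕ, 0 < k ∧ t = k / 2 ^ m})

/-- A positive dyadic number as a real number. -/
def val (t : PosDyadic) : ℝ≥0 := t.1

instance : Add PosDyadic where
  add s t := ⟨s.1 + t.1, by
    obtain ⟨k, m, hk, hs⟩ := s.2
    obtain ⟨l, n, hl, ht⟩ := t.2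
    refine ⟨k * 2 ^ n + l * 2 ^ m, m + n, by positivity, ?_⟩
    rw [hs, ht]
    push_cast
    rw [pow_add]
    field_simp⟩

theorem val_add (s t : PosDyadic) : (s + t).val = s.val + t.val := rfl

/-- The dyadic number `2⁻ⁿ`. -/
def twoPowNeg (n : ℕ) : PosDyadic := ⟨1 / 2 ^ n, 1, n, one_pos, by simp⟩

end PosDyadic

/-- A semigroup `(q t)` indexed by the positive dyadic numbers `t`. -/
structure DyadicSemigroup (A : Type*) [Mul A] where
  toFun : PosDyadic → A
  map_add : ∀ s t, toFun (s + t) = toFun s * toFun t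

instance (A : Type*) [Mul A] : CoeFun (DyadicSemigroup A) fun _ => PosDyadic → A :=
  ⟨DyadicSemigroup.toFun⟩

instance (E : Type*) [NormedAddCommGroup E] [NormedSpace ℂ E] :
    CoeFun (C0Semigroup E) fun _ => ℝ≥0 → E →L[ℂ] E :=
  ⟨C0Semigroup.toFun⟩

namespace DyadicSemigroup

theorem eq_pow {A : Type*} [Monoid A] (q : DyadicSemigroup A) (k : ℕ) :
    ∀ s t : PosDyadic, t.val = (k + 1 : ℕ) * s.val → q t = q s ^ (k + 1) := by
  induction k with
  | zero =>
    intro s t h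
    have : t = s := Subtype.ext (by simpa [PosDyadic.val] using h)
    rw [this, zero_add, pow_one]
  | succ k ih =>
    intro s t h
    have hs : ∃ r : PosDyadic, r.val = (k + 1 : ℕ) * s.val := by
      obtain ⟨l, m, hl, hs⟩ := s.2
      refine ⟨⟨(k + 1 : ℕ) * s.1, (k + 1) * l, m, by positivity, ?_⟩, rfl⟩
      rw [hs]
      push_cast
      ring
    obtain ⟨r, hr⟩ := hs
    have : t = r + s := Subtype.ext (by
      change t.val = r.val + s.val
      rw [h, hr]
      push_cast
      ring)
    rw [this, q.map_add, ih s r hr, ← pow_succ]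

theorem exists_eq_pow {A : Type*} [Monoid A] (q : DyadicSemigroup A) (t : PosDyadic) :
    ∃ n k : ℕ, q t = q (PosDyadic.twoPowNeg n) ^ k := by
  obtain ⟨k, m, hk, ht⟩ := t.2
  obtain ⟨k, rfl⟩ := Nat.exists_eq_succ_of_ne_zero hk.ne'
  refine ⟨m, k + 1, q.eq_pow k _ _ ?_⟩
  change t.1 = _ * (1 / 2 ^ m)
  rw [ht]
  push_cast
  ring

theorem commute {A : Type*} [Monoid A] (q : DyadicSemigroup A) (s t : PosDyadic) :
    q s * q t = q t * q s := by
  rw [← q.map_add, ← q.map_add]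
  exact congrArg q (Subtype.ext (add_comm s.1 t.1))

/-- All the elements of the semigroup are normal. -/
def IsNormal {A : Type*} [Mul A] [Star A] (q : DyadicSemigroup A) : Prop :=
  ∀ t, IsStarNormal (q t)

/-- Strong operator continuity. -/
def IsSOTContinuous {E : Type*} [NormedAddCommGroup E] [NormedSpace ℂ E]
    (Q : DyadicSemigroup (E →L[ℂ] E)) : Prop :=
  ∀ x : E, Continuous fun t => Q t x

/-- The dyadic semigroup extends to a `C₀`-semigroup defined on `[0, ∞)`. -/
def ExtendsToC0 {E : Type*} [NormedAddCommGroup E] [NormedSpace ℂ E]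
    (Q : DyadicSemigroup (E →L[ℂ] E)) : Prop :=
  ∃ T : C0Semigroup E, ∀ t : PosDyadic, T t.val = Q t

/-- The image of a dyadic semigroup under a homomorphism. -/
def map {A B : Type*} [Ring A] [Algebra ℂ A] [Star A] [Ring B] [Algebra ℂ B] [Star B]
    (f : A →⋆ₐ[ℂ] B) (q : DyadicSemigroup A) : DyadicSemigroup B where
  toFun t := f (q t)
  map_add s t := by rw [q.map_add, _root_.map_mul]

section CStar

variable {A : Type*} [CStarAlgebra A] (q : DyadicSemigroup A)

/-- The unital C⋆-algebra `C⋆({q(2⁻ⁿ) : n = 0, 1, 2, …} ∪ {1})`. -/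
def algebra : StarSubalgebra ℂ A :=
  (StarAlgebra.adjoin ℂ (Set.range fun n : ℕ => q (PosDyadic.twoPowNeg n))).topologicalClosure

instance : IsClosed (q.algebra : Set A) := StarSubalgebra.isClosed_topologicalClosure _

theorem mem_algebra (t : PosDyadic) : q t ∈ q.algebra := by
  obtain ⟨n, k, h⟩ := q.exists_eq_pow t
  rw [h]
  exact pow_mem (StarSubalgebra.le_topologicalClosure _
    (StarAlgebra.subset_adjoin ℂ _ (Set.mem_range_self n))) k

variable {q} in
theorem IsNormal.commute_star (hq : q.IsNormal) (m n : ℕ) :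
    Commute (q (PosDyadic.twoPowNeg m)) (star (q (PosDyadic.twoPowNeg n))) := by
  have key : ∀ m j : ℕ, q (PosDyadic.twoPowNeg m) = q (PosDyadic.twoPowNeg (m + j)) ^ (2 ^ j) := by
    intro m j
    obtain ⟨k, hk⟩ := Nat.exists_eq_succ_of_ne_zero (pow_ne_zero j (two_ne_zero (α := ℕ)))
    rw [hk]
    refine q.eq_pow k _ _ ?_
    rw [← Nat.succ_eq_add_one, ← hk]
    change (1 / 2 ^ m : ℝ≥0) = _ * (1 / 2 ^ (m + j))
    rw [pow_add]
    push_cast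
    field_simp
  have hn : ∀ k, Commute (q (PosDyadic.twoPowNeg k)) (star (q (PosDyadic.twoPowNeg k))) :=
    fun k => ((hq _).star_comm_self).symm
  rcases le_total m n with h | h
  · obtain ⟨j, rfl⟩ := Nat.exists_eq_add_of_le h
    rw [key m j]
    exact (hn _).pow_left _
  · obtain ⟨j, rfl⟩ := Nat.exists_eq_add_of_le h
    rw [key n j, star_pow]
    exact (hn _).pow_right _

variable {q} in
/-- The algebra generated by a normal dyadic semigroup is commutative. -/
theorem IsNormal.algebra_mul_comm (hq : q.IsNormal) (a b : q.algebra) : a * b = b * a := by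
  have h1 : IsMulCommutative
      (StarAlgebra.adjoin ℂ (Set.range fun n : ℕ => q (PosDyadic.twoPowNeg n))) := by
    refine StarAlgebra.isMulCommutative_adjoin ℂ ?_ ?_
    · rintro _ ⟨m, rfl⟩ _ ⟨n, rfl⟩
      exact q.commute _ _
    · rintro _ ⟨m, rfl⟩ _ ⟨n, rfl⟩
      exact hq.commute_star m n
  exact (StarSubalgebra.commRingTopologicalClosure _ h1.is_comm.comm).mul_comm a b

/-- The maximal ideal space `Δ` of the algebra generated by `q`. -/
abbrev Delta : Type _ := WeakDual.characterSpace ℂ q.algebra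

/-- The Gelfand transform of `q t`. -/
def gelfand (t : PosDyadic) : C(q.Delta, ℂ) :=
  WeakDual.gelfandTransform ℂ q.algebra ⟨q t, q.mem_algebra t⟩

variable {q} in
/-- The Gelfand transform as an isomorphism of C⋆-algebras. -/
def IsNormal.gelfandEquiv (hq : q.IsNormal) : q.algebra ≃⋆ₐ[ℂ] C(q.Delta, ℂ) :=
  letI : CommCStarAlgebra q.algebra :=
    { (inferInstance : CStarAlgebra q.algebra) with mul_comm := hq.algebra_mul_comm }
  gelfandStarTransform q.algebra

variable {q} in
theorem IsNormal.gelfandEquiv_apply (hq : q.IsNormal) (a : q.algebra) :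
    hq.gelfandEquiv a = WeakDual.gelfandTransform ℂ q.algebra a := rfl

end CStar

end DyadicSemigroup

end Semigroups

section Extensions

variable (H : Type*) [NormedAddCommGroup H] [InnerProductSpace ℂ H] [CompleteSpace H]
  (X : Type*) [TopologicalSpace X]

/-- An extension of `C(X)` by `K(H)`: a C⋆-subalgebra of `B(H)` containing the compact operators
and the identity, with a surjective `⋆`-homomorphism onto `C(X)` whose kernel is `K(H)`. -/
structure Extension where
  algebra : StarSubalgebra ℂ (H →L[ℂ] H)
  isClosed : IsClosed (algebra : Set (H →L[ℂ] H))
  mem_of_isCompactOperator : ∀ T : H →L[ℂ] H, IsCompactOperator T → T ∈ algebra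
  hom : algebra →⋆ₐ[ℂ] C(X, ℂ)
  surjective : Function.Surjective hom
  hom_eq_zero_iff : ∀ T : algebra, hom T = 0 ↔ IsCompactOperator (T : H →L[ℂ] H)

variable {H X}

namespace Extension

variable (Γ : Extension H X)

theorem mk_eq_of_hom_eq {S T : Γ.algebra} (h : Γ.hom S = Γ.hom T) :
    Calkin.mk H S = Calkin.mk H T := by
  rw [← sub_eq_zero, ← map_sub, Calkin.mk_eq_zero_iff]
  have := (Γ.hom_eq_zero_iff (S - T)).1 (by rw [map_sub, h, sub_self])
  exact this

/-- A preimage of a function in the algebra of the extension. -/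
def lift (g : C(X, ℂ)) : Γ.algebra := (Γ.surjective g).choose

theorem hom_lift (g : C(X, ℂ)) : Γ.hom (Γ.lift g) = g := (Γ.surjective g).choose_spec

/-- The Busby invariant `τ = π φ⁻¹ : C(X) → Q(H)` of an extension `(𝒜, φ)`. -/
def busby : C(X, ℂ) →⋆ₐ[ℂ] Calkin H where
  toFun g := Calkin.mk H (Γ.lift g)
  map_one' := by
    rw [Γ.mk_eq_of_hom_eq (T := 1) (by rw [hom_lift, map_one])]
    exact map_one _
  map_zero' := by
    rw [Γ.mk_eq_of_hom_eq (T := 0) (by rw [hom_lift, map_zero])]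
    exact map_zero _
  map_mul' f g := by
    rw [Γ.mk_eq_of_hom_eq (T := Γ.lift f * Γ.lift g) (by rw [map_mul]; simp only [hom_lift])]
    exact map_mul _ _ _
  map_add' f g := by
    rw [Γ.mk_eq_of_hom_eq (T := Γ.lift f + Γ.lift g) (by rw [map_add]; simp only [hom_lift])]
    exact map_add _ _ _
  commutes' c := by
    rw [Γ.mk_eq_of_hom_eq (T := algebraMap ℂ _ c) (by rw [hom_lift, AlgHomClass.commutes])]
    exact AlgHomClass.commutes (Calkin.mk H) c
  map_star' f := by
    rw [Γ.mk_eq_of_hom_eq (T := star (Γ.lift f)) (by rw [map_star]; simp only [hom_lift])]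
    exact map_star _ _

theorem busby_hom (T : Γ.algebra) : Γ.busby (Γ.hom T) = Calkin.mk H T :=
  Γ.mk_eq_of_hom_eq (Γ.hom_lift _)

end Extension

/-- Equivalence of Busby invariants: `τ₂ = π(U)⋆ τ₁ π(U)` for some unitary `U ∈ B(H)`. -/
def BusbyEquivalent (τ₁ τ₂ : C(X, ℂ) →⋆ₐ[ℂ] Calkin H) : Prop :=
  ∃ U ∈ unitary (H →L[ℂ] H), ∀ g : C(X, ℂ),
    τ₂ g = star (Calkin.mk H U) * τ₁ g * Calkin.mk H U

/-- `σ g = ⨁ᵢ g(ξᵢ) Iᵢ` for a decomposition of `H` as the orthogonal sum of a sequence of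
infinite-dimensional subspaces and a dense sequence `ξ` in `X`. -/
def IsDiagonalSum (σ : C(X, ℂ) →⋆ₐ[ℂ] (H →L[ℂ] H)) : Prop :=
  ∃ (ξ : ℕ → X) (V : ℕ → Submodule ℂ H), DenseRange ξ ∧
    IsHilbertSum ℂ (fun i => V i) (fun i => (V i).subtypeₗᵢ) ∧
    (∀ i, ¬ FiniteDimensional ℂ (V i)) ∧
    ∀ (g : C(X, ℂ)) (i : ℕ), ∀ v ∈ V i, σ g v = g (ξ i) • v

namespace Extension

variable (Γ : Extension H X)

/-- `Γ = Θ`: the extension represents the zero element of `Ext(X)`, that is, its Busby invariant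
is equivalent to `π ∘ σ` for some `σ g = ⨁ᵢ g(ξᵢ) Iᵢ`. -/
def IsZero : Prop :=
  ∃ σ : C(X, ℂ) →⋆ₐ[ℂ] (H →L[ℂ] H), IsDiagonalSum σ ∧
    BusbyEquivalent ((Calkin.mk H).comp σ) Γ.busby

/-- A splitting of an extension. -/
def IsSplitting (ρ : C(X, ℂ) →⋆ₐ[ℂ] Γ.algebra) : Prop :=
  ∀ g, Γ.hom (ρ g) = g

end Extension

namespace DyadicSemigroup

variable {q : DyadicSemigroup (Calkin H)}

/-- The extension `0 → K(H) → ℰ → C(Δ) → 0` associated with a normal dyadic semigroup in the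
Calkin algebra: `ℰ = π⁻¹(𝒜)`, with `𝒜` the C⋆-algebra generated by the semigroup, and the map
onto `C(Δ)` takes `T` to the Gelfand transform of `π T`. -/
def IsNormal.extension (hq : q.IsNormal) : Extension H q.Delta where
  algebra := q.algebra.comap (Calkin.mk H)
  isClosed := by
    have hc : Continuous (Calkin.mk H) :=
      AddMonoidHomClass.continuous_of_bound (Calkin.mk H) 1 fun T => by
        rw [one_mul]; exact Calkin.norm_mk_le T
    exact (inferInstance : IsClosed (q.algebra : Set (Calkin H))).preimage hc
  mem_of_isCompactOperator T hT := by
    change Calkin.mk H T ∈ q.algebra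
    rw [Calkin.mk_eq_zero_iff.2 hT]
    exact zero_mem _
  hom := (hq.gelfandEquiv : q.algebra →⋆ₐ[ℂ] C(q.Delta, ℂ)).comp
    (((Calkin.mk H).comp (q.algebra.comap (Calkin.mk H)).subtype).codRestrict q.algebra
      fun T => T.2)
  surjective g := by
    obtain ⟨a, rfl⟩ := hq.gelfandEquiv.surjective g
    obtain ⟨T, hT⟩ := Calkin.mk_surjective H a
    refine ⟨⟨T, by change Calkin.mk H T ∈ q.algebra; rw [hT]; exact a.2⟩, ?_⟩
    exact congrArg hq.gelfandEquiv (Subtype.ext hT)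
  hom_eq_zero_iff T := by
    rw [← Calkin.mk_eq_zero_iff]
    refine (map_eq_zero_iff _ hq.gelfandEquiv.injective).trans ?_
    exact ZeroMemClass.coe_eq_zero.symm

theorem IsNormal.extension_hom (hq : q.IsNormal) (T : hq.extension.algebra) :
    hq.extension.hom T = WeakDual.gelfandTransform ℂ q.algebra ⟨Calkin.mk H T, T.2⟩ := rfl

end DyadicSemigroup

end Extensions

end CalkinLift

end

/-!
A unitary `W` and a diagonal sum `σ` with `τ = π(W)⋆ (π ∘ σ) π(W)` give the splitting
`g ↦ W⋆ (σ g) W` at once, and the image of a semigroup under any splitting `ρ` is a semigroup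
lifting it; the substance is the strong continuity of `t ↦ ρ (gelfand t)`.

A splitting is faithful modulo the compact operators: `ρ h` compact forces `h = θ (ρ h) = 0`. So for
a point `p` of `Δ` and bump functions `h` shrinking to `p`, the operators `ρ h` have
infinite-dimensional range, and unit vectors chosen in these ranges can be made orthonormal. They
form a weakly null sequence of approximate joint eigenvectors, hence a unit vector `ξ ∈ ℍ` with
`γ (q t) ξ = gelfand t p • ξ` for all `t` (`IsNormal.exists_eigenvector`). The `C₀`-semigroup on `ℍ`
applied to `ξ` shows that `gelfand t p → 1` as `t → 0`, and that `|gelfand t p|` is bounded for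
bounded `t`, uniformly in `p`.

Dominated convergence for the spectral measure of `ρ` at a vector, obtained from the
Riesz–Markov–Kakutani theorem (`tendsto_rep_apply_zero`), turns this into `ρ (gelfand t) x → x` as
`t → 0`. A locally bounded dyadic semigroup that is strongly continuous at `0` is uniformly
continuous on orbits over bounded sets and extends to `[0, ∞)` by density
(`extendsToC0_of_tendsto`).
-/

open Filter Topology
open scoped NNReal

namespace CalkinLift

/-! ### Extending dyadic semigroups of operators to `[0, ∞)` -/

namespace PosDyadic

theorem isInducing_val : IsInducing val := ⟨rfl⟩

theorem val_pos (t : PosDyadic) : 0 < t.val := by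
  obtain ⟨k, m, hk, ht⟩ := t.2
  change 0 < t.1
  rw [ht]
  positivity

theorem exists_add_eq {s t : PosDyadic} (h : s.val < t.val) : ∃ r : PosDyadic, s + r = t := by
  obtain ⟨k, m, -, hs⟩ := s.2
  obtain ⟨l, n, -, ht⟩ := t.2
  change s.1 < t.1 at h
  have hlt : k * 2 ^ n < l * 2 ^ m := by
    rw [hs, ht, div_lt_div_iff₀ (by positivity) (by positivity)] at h
    exact_mod_cast h
  obtain ⟨d, hd⟩ := Nat.exists_eq_add_of_lt hlt
  refine ⟨⟨(d + 1 : ℕ) / 2 ^ (m + n), d + 1, m + n, Nat.succ_pos d, rfl⟩, Subtype.ext ?_⟩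
  change s.1 + ((d + 1 : ℕ) : ℝ≥0) / 2 ^ (m + n) = t.1
  have hd' : (l : ℝ≥0) * 2 ^ m = k * 2 ^ n + (d + 1 : ℕ) := by
    rw [add_assoc] at hd
    exact_mod_cast hd
  rw [hs, ht, div_add_div _ _ (by positivity) (by positivity),
    div_eq_div_iff (by positivity) (by positivity)]
  linear_combination (2 : ℝ≥0) ^ (m + n) * hd'.symm

theorem denseRange_val : DenseRange val := by
  refine dense_iff_inter_open.2 fun O hO ⟨b, hb⟩ => ?_
  obtain ⟨ε, hε, hball⟩ := Metric.isOpen_iff.1 hO b hb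
  obtain ⟨m, hm⟩ := exists_pow_lt_of_lt_one hε (show (1 / 2 : ℝ) < 1 by norm_num)
  have hp : (0 : ℝ) < 2 ^ m := by positivity
  have h1 := Nat.lt_floor_add_one ((b : ℝ) * 2 ^ m)
  have h2 := Nat.floor_le (show 0 ≤ (b : ℝ) * 2 ^ m by positivity)
  refine ⟨_, hball ?_, ⟨⟨(⌊(b : ℝ) * 2 ^ m⌋₊ + 1 : ℕ) / 2 ^ m, _, m, Nat.succ_pos _, rfl⟩, rfl⟩⟩
  rw [Metric.mem_ball, NNReal.dist_eq, abs_lt]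
  simp only [val]
  push_cast
  have h3 : ((⌊(b : ℝ) * 2 ^ m⌋₊ : ℝ) + 1) / 2 ^ m ≤ b + (1 / 2) ^ m := by
    rw [div_pow, one_pow, div_le_iff₀ hp, add_mul, div_mul_cancel₀ _ hp.ne']
    linarith
  have h4 : (b : ℝ) < ((⌊(b : ℝ) * 2 ^ m⌋₊ : ℝ) + 1) / 2 ^ m := by rwa [lt_div_iff₀ hp]
  constructor <;> linarith

theorem isDenseInducing_val : IsDenseInducing val := ⟨isInducing_val, denseRange_val⟩

end PosDyadic

namespace DyadicSemigroup

variable {E : Type*} [NormedAddCommGroup E] [NormedSpace ℂ E]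

/-- A dyadic semigroup which is locally bounded and strongly continuous at `0` has limits along the
dyadic numbers at every point of `[0, ∞)`. -/
theorem exists_tendsto_comap_val [CompleteSpace E] (Q : DyadicSemigroup (E →L[ℂ] E))
    (hb : ∀ N : ℝ≥0, ∃ M : ℝ, ∀ t : PosDyadic, t.val ≤ N → ‖Q t‖ ≤ M)
    (h0 : ∀ x, Tendsto (fun t => Q t x) (comap PosDyadic.val (𝓝 0)) (𝓝 x)) (x : E) (b : ℝ≥0) :
    ∃ c, Tendsto (fun t => Q t x) (comap PosDyadic.val (𝓝 b)) (𝓝 c) := by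
  have := PosDyadic.isDenseInducing_val.comap_nhds_neBot b
  refine cauchy_map_iff_exists_tendsto.1 (Metric.cauchy_iff.2 ⟨inferInstance, fun ε hε => ?_⟩)
  obtain ⟨M, hM⟩ := hb (b + 1)
  -- a positive bound, so that one can divide by it
  set M' := max M 1
  have hM' : 0 < M' := lt_max_of_lt_right one_pos
  obtain ⟨δ, hδ, h⟩ := ((Metric.nhds_basis_ball.comap PosDyadic.val).tendsto_iff
    Metric.nhds_basis_ball).1 (h0 x) (ε / M') (by positivity)
  have key : ∀ s t : PosDyadic, s.val ≤ b + 1 → dist s.val t.val < δ → s.val < t.val →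
      dist (Q t x) (Q s x) < ε := by
    intro s t hs hst hlt
    obtain ⟨r, rfl⟩ := PosDyadic.exists_add_eq hlt
    have hr : dist (Q r x) x < ε / M' := by
      refine h r ?_
      rw [PosDyadic.val_add, NNReal.dist_eq] at hst
      rw [Set.mem_preimage, Metric.mem_ball, NNReal.dist_eq]
      push_cast at hst ⊢
      rw [abs_sub_comm] at hst
      simpa using hst
    rw [dist_eq_norm] at hr ⊢
    rw [Q.map_add, mul_apply_eq_comp, ← map_sub]
    calc ‖Q s (Q r x - x)‖ ≤ M' * ‖Q r x - x‖ :=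
          (Q s).le_of_opNorm_le ((hM s hs).trans (le_max_left _ _)) _
      _ < M' * (ε / M') := by gcongr
      _ = ε := by field_simp
  refine ⟨_, image_mem_map (preimage_mem_comap (Metric.ball_mem_nhds b
    (lt_min one_pos (half_pos hδ)))), ?_⟩
  rintro _ ⟨s, hs, rfl⟩ _ ⟨t, ht, rfl⟩
  simp only [Set.mem_preimage, Metric.mem_ball, lt_min_iff] at hs ht
  have hle : ∀ u : ℝ≥0, dist u b < 1 → u ≤ b + 1 := fun u hu => by
    rw [NNReal.dist_eq, abs_lt] at hu
    rw [← NNReal.coe_le_coe]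
    push_cast
    linarith [hu.2]
  have hst : dist s.val t.val < δ :=
    (dist_triangle_right s.val t.val b).trans_lt (by linarith [hs.2, ht.2])
  rcases lt_trichotomy s.val t.val with hlt | heq | hlt
  · rw [dist_comm]
    exact key s t (hle _ hs.1) hst hlt
  · rw [show s = t from Subtype.ext heq, dist_self]
    exact hε
  · exact key t s (hle _ ht.1) (by rwa [dist_comm]) hlt

/-- A limit along a filter containing the point itself must be the value, so the existence of the
limits already gives continuity. -/
theorem isSOTContinuous_of_tendsto [CompleteSpace E] (Q : DyadicSemigroup (E →L[ℂ] E))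
    (hb : ∀ N : ℝ≥0, ∃ M : ℝ, ∀ t : PosDyadic, t.val ≤ N → ‖Q t‖ ≤ M)
    (h0 : ∀ x, Tendsto (fun t => Q t x) (comap PosDyadic.val (𝓝 0)) (𝓝 x)) :
    Q.IsSOTContinuous := by
  refine fun x => continuous_iff_continuousAt.2 fun t => ?_
  obtain ⟨c, hc⟩ := Q.exists_tendsto_comap_val hb h0 x t.val
  rw [← PosDyadic.isInducing_val.nhds_eq_comap] at hc
  exact continuousAt_of_tendsto_nhds hc

/-- The operators `T b` are the strong limits of `Q t` as `t → b` along the dyadic numbers. Their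
orbits are continuous, so the semigroup law extends by density in each variable separately. -/
theorem extendsToC0_of_tendsto [CompleteSpace E] (Q : DyadicSemigroup (E →L[ℂ] E))
    (hb : ∀ N : ℝ≥0, ∃ M : ℝ, ∀ t : PosDyadic, t.val ≤ N → ‖Q t‖ ≤ M)
    (h0 : ∀ x, Tendsto (fun t => Q t x) (comap PosDyadic.val (𝓝 0)) (𝓝 x)) :
    Q.ExtendsToC0 := by
  choose S hS using fun b x => Q.exists_tendsto_comap_val hb h0 x b
  have hne := PosDyadic.isDenseInducing_val.comap_nhds_neBot
  have hcont : ∀ x, Continuous fun b => S b x := fun x => by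
    have := PosDyadic.isDenseInducing_val.continuous_extend fun b => ⟨S b x, hS b x⟩
    convert this using 2 with b
    exact (PosDyadic.isDenseInducing_val.extend_eq_of_tendsto (hS b x)).symm
  have hval : ∀ (t : PosDyadic) x, S t.val x = Q t x := fun t x => by
    have h := hS t.val x
    rw [← PosDyadic.isInducing_val.nhds_eq_comap] at h
    exact tendsto_nhds_unique h ((Q.isSOTContinuous_of_tendsto hb h0 x).tendsto t)
  have hbound : ∀ b, ∃ M, ∀ x, ‖S b x‖ ≤ M * ‖x‖ := fun b => by
    obtain ⟨M, hM⟩ := hb (b + 1)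
    refine ⟨M, fun x => le_of_tendsto (hS b x).norm ?_⟩
    filter_upwards [preimage_mem_comap (Iic_mem_nhds (lt_add_one b))] with t ht
    exact (Q t).le_of_opNorm_le (hM t ht) x
  choose M hM using hbound
  let T : ℝ≥0 → E →L[ℂ] E := fun b => LinearMap.mkContinuous
    { toFun := S b
      map_add' := fun x y => tendsto_nhds_unique (hS b (x + y))
        (((hS b x).add (hS b y)).congr fun t => ((Q t).map_add x y).symm)
      map_smul' := fun c x => tendsto_nhds_unique (hS b (c • x))
        (((hS b x).const_smul c).congr fun t => ((Q t).map_smul c x).symm) } (M b) (hM b)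
  have hT : ∀ b x, T b x = S b x := fun _ _ => rfl
  have hTcont : ∀ x, Continuous fun b => T b x := hcont
  have hTval : ∀ t : PosDyadic, T t.val = Q t := fun t => ContinuousLinearMap.ext (hval t)
  have hadd : ∀ (s : PosDyadic) (b : ℝ≥0) x, T (s.val + b) x = T s.val (T b x) := fun s b x => by
    refine congrFun (PosDyadic.denseRange_val.equalizer (g := fun b => T (s.val + b) x)
      (h := fun b => T s.val (T b x)) ((hTcont x).comp (continuous_const_add _))
      ((T s.val).continuous.comp (hTcont x)) (funext fun t => ?_)) b
    simp only [Function.comp_apply]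
    rw [← PosDyadic.val_add, hTval, hTval, hTval, Q.map_add, mul_apply_eq_comp]
  refine ⟨⟨T, ContinuousLinearMap.ext fun x => tendsto_nhds_unique (hS 0 x) (h0 x), fun a b =>
    ContinuousLinearMap.ext fun x => ?_, hTcont⟩, hTval⟩
  refine congrFun (PosDyadic.denseRange_val.equalizer (g := fun a => T (a + b) x)
    (h := fun a => T a (T b x)) ((hTcont x).comp (continuous_add_const _))
    (hTcont (T b x)) (funext fun s => hadd s b x)) a

end DyadicSemigroup

/-! ### Representations of `C(X)` -/

section Representations

variable {H : Type*} [NormedAddCommGroup H] [InnerProductSpace ℂ H] [CompleteSpace H]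
  {X : Type*} [TopologicalSpace X]

theorem norm_sq_rep_apply (ρ : C(X, ℂ) →⋆ₐ[ℂ] (H →L[ℂ] H)) (g : C(X, ℂ)) (x : H) :
    ‖ρ g x‖ ^ 2 = RCLike.re (inner ℂ x (ρ (star g * g) x)) := by
  rw [map_mul, map_star, mul_apply_eq_comp, ContinuousLinearMap.star_eq_adjoint,
    ContinuousLinearMap.adjoint_inner_right, inner_self_eq_norm_sq]

/-- The difference `‖ρ h x‖ ^ 2 - ‖ρ g x‖ ^ 2` is `‖ρ r x‖ ^ 2` with `r = √(|h|² - |g|²)`. -/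
theorem norm_rep_apply_le (ρ : C(X, ℂ) →⋆ₐ[ℂ] (H →L[ℂ] H)) {g h : C(X, ℂ)}
    (hgh : ∀ p, ‖g p‖ ≤ ‖h p‖) (x : H) : ‖ρ g x‖ ≤ ‖ρ h x‖ := by
  let r : C(X, ℂ) := ⟨fun p => ((√(‖h p‖ ^ 2 - ‖g p‖ ^ 2) : ℝ) : ℂ), by fun_prop⟩
  have hr : star h * h = star g * g + star r * r := by
    ext p
    have h1 : √(‖h p‖ ^ 2 - ‖g p‖ ^ 2) * √(‖h p‖ ^ 2 - ‖g p‖ ^ 2) = ‖h p‖ ^ 2 - ‖g p‖ ^ 2 :=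
      Real.mul_self_sqrt (sub_nonneg.2 (pow_le_pow_left₀ (norm_nonneg _) (hgh p) 2))
    simp only [ContinuousMap.mul_apply, ContinuousMap.add_apply, ContinuousMap.star_apply,
      RCLike.star_def, Complex.conj_mul', r, ContinuousMap.coe_mk, Complex.conj_ofReal]
    rw [← Complex.ofReal_mul, h1]
    push_cast
    ring
  refine (pow_le_pow_iff_left₀ (norm_nonneg _) (norm_nonneg _) two_ne_zero).1 ?_
  have h2 := norm_sq_rep_apply ρ h x
  rw [hr, map_add, add_apply, inner_add_right, map_add, ← norm_sq_rep_apply,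
    ← norm_sq_rep_apply] at h2
  linarith [sq_nonneg ‖ρ r x‖]

theorem norm_rep_le (ρ : C(X, ℂ) →⋆ₐ[ℂ] (H →L[ℂ] H)) {g : C(X, ℂ)} {M : ℝ} (hM : 0 ≤ M)
    (hg : ∀ p, ‖g p‖ ≤ M) : ‖ρ g‖ ≤ M := by
  refine ContinuousLinearMap.opNorm_le_bound _ hM fun x => ?_
  have := norm_rep_apply_le ρ (g := g) (h := algebraMap ℂ C(X, ℂ) M)
    (fun p => by simpa [abs_of_nonneg hM] using hg p) x
  rw [AlgHomClass.commutes] at this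
  simpa [ContinuousLinearMap.algebraMap_apply, norm_smul, abs_of_nonneg hM] using this

/-- Bounded pointwise convergence in `C(X)` gives strong convergence of the represented operators:
this is dominated convergence for the spectral measure of the vector, which comes from the
Riesz–Markov–Kakutani theorem. -/
theorem tendsto_rep_apply_zero [CompactSpace X] [T2Space X] (ρ : C(X, ℂ) →⋆ₐ[ℂ] (H →L[ℂ] H))
    {ι : Type*} {l : Filter ι} [l.IsCountablyGenerated] {g : ι → C(X, ℂ)} {M : ℝ}
    (hM : ∀ᶠ i in l, ∀ p, ‖g i p‖ ≤ M) (hg : ∀ p, Tendsto (fun i => g i p) l (𝓝 0)) (x : H) :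
    Tendsto (fun i => ρ (g i) x) l (𝓝 0) := by
  borelize X
  let c : C(X, ℝ) → C(X, ℂ) := fun f => ⟨fun p => (f p : ℂ), by fun_prop⟩
  let L : CompactlySupportedContinuousMap X ℝ →ₗ[ℝ] ℝ :=
    { toFun := fun f => RCLike.re (inner ℂ x (ρ (c f) x))
      map_add' := fun f g => by
        have : c (f + g : CompactlySupportedContinuousMap X ℝ) = c f + c g := by ext p; simp [c]
        rw [this, map_add, add_apply, inner_add_right, map_add]
      map_smul' := fun a f => by
        have : c (a • f : CompactlySupportedContinuousMap X ℝ) = (a : ℂ) • c f := by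
          ext p; simp [c]
        rw [this, map_smul, smul_apply, inner_smul_right]
        simp }
  have hL : ∀ f, 0 ≤ f → 0 ≤ L f := fun f hf => by
    have : c f = star (c ⟨fun p => √(f p), by fun_prop⟩) * c ⟨fun p => √(f p), by fun_prop⟩ := by
      ext p
      simp only [c, ContinuousMap.coe_mk, ContinuousMap.mul_apply, ContinuousMap.star_apply,
        RCLike.star_def, Complex.conj_ofReal]
      rw [← Complex.ofReal_mul, Real.mul_self_sqrt (hf p)]
    change 0 ≤ RCLike.re (inner ℂ x (ρ (c f) x))
    rw [this, ← norm_sq_rep_apply]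
    positivity
  let Λ := PositiveLinearMap.mk₀ L hL
  let μ := RealRMK.rieszMeasure Λ
  let s : ι → CompactlySupportedContinuousMap X ℝ := fun i =>
    CompactlySupportedContinuousMap.continuousMapEquiv ⟨fun p => ‖g i p‖ ^ 2, by fun_prop⟩
  have hs : ∀ i, ‖ρ (g i) x‖ ^ 2 = ∫ p, ‖g i p‖ ^ 2 ∂μ := fun i => by
    have h1 : c (s i) = star (g i) * g i := by
      ext p
      simp only [ContinuousMap.mul_apply, ContinuousMap.star_apply, RCLike.star_def,
        Complex.conj_mul']
      exact Complex.ofReal_pow _ _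
    rw [norm_sq_rep_apply, ← h1]
    exact (RealRMK.integral_rieszMeasure Λ (s i)).symm
  have hlim : Tendsto (fun i => ∫ p, ‖g i p‖ ^ 2 ∂μ) l (𝓝 (∫ _, (0 : ℝ) ∂μ)) := by
    refine MeasureTheory.tendsto_integral_filter_of_dominated_convergence (fun _ => M ^ 2)
      (Eventually.of_forall fun i => ?_) ?_ (MeasureTheory.integrable_const _) ?_
    · exact Continuous.aestronglyMeasurable (by fun_prop)
    · filter_upwards [hM] with i hi
      refine Eventually.of_forall fun p => ?_
      rw [norm_pow, norm_norm]
      exact pow_le_pow_left₀ (norm_nonneg _) (hi p) 2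
    · exact Eventually.of_forall fun p => by simpa using (hg p).norm.pow 2
  simp_rw [← hs, MeasureTheory.integral_zero] at hlim
  rw [tendsto_zero_iff_norm_tendsto_zero]
  simpa using hlim.sqrt

end Representations

/-! ### Points of the spectrum as eigenvalues in the Calkin representation -/

section Eigenvectors

variable {H : Type*} [NormedAddCommGroup H] [InnerProductSpace ℂ H] [CompleteSpace H]

/-- The range of a non-compact operator is infinite-dimensional, hence meets the orthogonal
complement of every finite-dimensional subspace. -/
theorem exists_apply_mem_orthogonal {T : H →L[ℂ] H} (hT : ¬ IsCompactOperator T)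
    (V : Submodule ℂ H) [FiniteDimensional ℂ V] : ∃ y, T y ∈ Vᗮ ∧ ‖T y‖ = 1 := by
  by_contra! hcon
  have h0 : ∀ y, T y ∈ Vᗮ → T y = 0 := fun y hy => by
    by_contra hne
    refine hcon (((‖T y‖⁻¹ : ℝ) : ℂ) • y) ?_ ?_
    · rw [map_smul]
      exact Vᗮ.smul_mem _ hy
    · rw [map_smul, norm_smul, Complex.norm_real, norm_inv, norm_norm,
        inv_mul_cancel₀ (norm_ne_zero_iff.2 hne)]
  let R : Submodule ℂ H := LinearMap.range (T : H →ₗ[ℂ] H)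
  have hinj : Function.Injective
      ((V.orthogonalProjectionOnto : H →ₗ[ℂ] V).comp R.subtype) := by
    rw [← LinearMap.ker_eq_bot, LinearMap.ker_eq_bot']
    rintro ⟨_, y, rfl⟩ hy
    refine Subtype.ext (h0 y ?_)
    exact (Submodule.orthogonalProjectionOnto_eq_zero_iff).1 hy
  have hfin : FiniteDimensional ℂ R := FiniteDimensional.of_injective _ hinj
  refine hT ?_
  have : T = R.starProjection * T := ContinuousLinearMap.ext fun y =>
    (Submodule.starProjection_eq_self_iff.2 (LinearMap.mem_range_self (T : H →ₗ[ℂ] H) y)).symm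
  rw [this]
  exact (isCompactOperator_starProjection R).comp_clm T

omit [CompleteSpace H] in
theorem mem_weaklyNull_of_orthonormal {x : ℕ → H} (hx : Orthonormal ℂ x) :
    x ∈ weaklyNull H := fun y => by
  have h := (hx.inner_products_summable (x := y)).tendsto_atTop_zero.sqrt
  simp only [Real.sqrt_sq (norm_nonneg _), Real.sqrt_zero] at h
  refine tendsto_zero_iff_norm_tendsto_zero.2 (h.congr fun n => ?_)
  rw [← inner_conj_symm, RCLike.norm_conj]

/-- If the representation `ρ` is faithful modulo the compact operators, every point `p` gives
approximate joint eigenvectors of countably many operators `ρ (f j)`, with eigenvalues `f j p`,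
which can be chosen orthonormal: take them in the (infinite-dimensional) ranges of `ρ h` for bump
functions `h` concentrated near `p`. -/
theorem exists_orthonormal_tendsto {X : Type*} [TopologicalSpace X]
    (ρ : C(X, ℂ) →⋆ₐ[ℂ] (H →L[ℂ] H)) (hρ : ∀ h, IsCompactOperator (ρ h) → h = 0)
    (f : ℕ → C(X, ℂ)) (p : X) :
    ∃ x : ℕ → H, Orthonormal ℂ x ∧
      ∀ j, Tendsto (fun k => ρ (f j) (x k) - f j p • x k) atTop (𝓝 0) := by
  let P : ℕ × H → Prop := fun a => ‖a.2‖ = 1 ∧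
    ∀ j ≤ a.1, ‖ρ (f j) a.2 - f j p • a.2‖ ≤ 1 / ((a.1 : ℝ) + 1)
  have step : ∀ (k : ℕ) (V : Submodule ℂ H) [FiniteDimensional ℂ V], ∃ y ∈ Vᗮ, P (k, y) := by
    intro k V _
    -- nonzero at `p`, and nonzero only where `‖f j z - f j p‖ < 1 / (k + 1)` for all `j ≤ k`
    let h : C(X, ℂ) := ⟨fun z => ∏ j ∈ Finset.range (k + 1),
      ((max 0 (1 / ((k : ℝ) + 1) - ‖f j z - f j p‖) : ℝ) : ℂ), by fun_prop⟩
    have hne : h ≠ 0 := fun h0 => by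
      have h1 : h p = 0 := by rw [h0]; rfl
      simp only [h, ContinuousMap.coe_mk, Finset.prod_eq_zero_iff, sub_self, norm_zero, sub_zero,
        Complex.ofReal_eq_zero] at h1
      obtain ⟨j, -, h1⟩ := h1
      have : (0 : ℝ) < 1 / ((k : ℝ) + 1) := by positivity
      rw [max_eq_right this.le] at h1
      exact this.ne' h1
    have hsupp : ∀ z, ∀ j ≤ k, h z = 0 ∨ ‖f j z - f j p‖ ≤ 1 / ((k : ℝ) + 1) := fun z j hj => by
      by_contra! hc
      refine hc.1 (Finset.prod_eq_zero (Finset.mem_range.2 (Nat.lt_succ_of_le hj)) ?_)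
      rw [max_eq_left (by linarith [hc.2]), Complex.ofReal_zero]
    obtain ⟨y, hyV, hy⟩ := exists_apply_mem_orthogonal (fun hc => hne (hρ h hc)) V
    refine ⟨ρ h y, hyV, hy, fun j hj => ?_⟩
    change _ ≤ 1 / ((k : ℝ) + 1)
    have hpos : (0 : ℝ) < 1 / ((k : ℝ) + 1) := by positivity
    have h1 : ρ (f j) (ρ h y) - f j p • ρ h y = ρ (f j * h - f j p • h) y := by
      rw [map_sub, map_mul, map_smul]
      rfl
    have h2 := norm_rep_apply_le ρ (g := f j * h - f j p • h)
      (h := ((1 / ((k : ℝ) + 1) : ℝ) : ℂ) • h) (fun z => by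
        rw [ContinuousMap.sub_apply, ContinuousMap.mul_apply, ContinuousMap.smul_apply,
          ContinuousMap.smul_apply, smul_eq_mul, smul_eq_mul, ← sub_mul, norm_mul, norm_mul,
          Complex.norm_real, Real.norm_of_nonneg hpos.le]
        rcases hsupp z j hj with h0 | h0
        · rw [h0]; simp
        · gcongr) y
    rw [h1]
    refine h2.trans_eq ?_
    rw [map_smul, smul_apply, norm_smul, hy, Complex.norm_real, Real.norm_of_nonneg hpos.le,
      mul_one]
  obtain ⟨a, ha, hlt⟩ := exists_seq_of_forall_finset_exists P
    -- the increasing first components force the error bounds in `P` to tend to `0`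
    (fun a b => a.1 < b.1 ∧ inner ℂ a.2 b.2 = 0) fun s _ => by
      obtain ⟨n, hn⟩ := (s.image Prod.fst).exists_nat_subset_range
      have : FiniteDimensional ℂ (Submodule.span ℂ (Prod.snd '' (s : Set (ℕ × H)))) :=
        FiniteDimensional.span_of_finite ℂ (s.finite_toSet.image _)
      obtain ⟨y, hyV, hy⟩ := step n (Submodule.span ℂ (Prod.snd '' (s : Set (ℕ × H))))
      refine ⟨(n, y), hy, fun b hb => ⟨?_, ?_⟩⟩
      · exact Finset.mem_range.1 (hn (Finset.mem_image_of_mem _ hb))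
      · exact hyV _ (Submodule.subset_span ⟨b, hb, rfl⟩)
  have hmono : StrictMono fun k => (a k).1 := fun m n hmn => (hlt m n hmn).1
  refine ⟨fun k => (a k).2, ⟨fun k => (ha k).1, fun m n hmn => ?_⟩, fun j => ?_⟩
  · rcases lt_or_gt_of_ne hmn with h | h
    · exact (hlt m n h).2
    · exact inner_eq_zero_symm.1 (hlt n m h).2
  · refine squeeze_zero_norm' ?_
      (tendsto_one_div_add_atTop_nhds_zero_nat.comp hmono.tendsto_atTop)
    filter_upwards [eventually_ge_atTop j] with k hk
    exact (ha k).2 j (hk.trans hmono.le_apply)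

/-- An orthonormal sequence of approximate joint eigenvectors is weakly null, so it defines a unit
vector of `ℍ`, which is an exact joint eigenvector. -/
theorem exists_eigenvector {U : Ultrafilter ℕ} (hU : (U : Filter ℕ) ≤ cofinite)
    {X : Type*} [TopologicalSpace X]
    (ρ : C(X, ℂ) →⋆ₐ[ℂ] (H →L[ℂ] H)) (hρ : ∀ h, IsCompactOperator (ρ h) → h = 0)
    (f : ℕ → C(X, ℂ)) (p : X) :
    ∃ ξ : CalkinSpace H U, ‖ξ‖ = 1 ∧
      ∀ j, calkinRep H hU (Calkin.mk H (ρ (f j))) ξ = f j p • ξ := by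
  obtain ⟨x, hx, hlim⟩ := exists_orthonormal_tendsto ρ hρ f p
  have hU' : (U : Filter ℕ) ≤ atTop := Nat.cofinite_eq_atTop ▸ hU
  let ξ : PreCalkinSpace H U := ⟨x, mem_weaklyNull_of_orthonormal hx⟩
  refine ⟨ξ, ?_, fun j => ?_⟩
  · rw [UniformSpace.Completion.norm_coe]
    have h := tendsto_nhds_unique (tendsto_norm_sq ξ)
      (tendsto_const_nhds.congr fun n => by rw [hx.1 n])
    exact (pow_eq_one_iff_of_nonneg (norm_nonneg _) two_ne_zero).1 (h.trans (one_pow 2))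
  · rw [calkinRep_mk, calkinPhi_coe, ← sub_eq_zero, ← UniformSpace.Completion.coe_smul,
      ← UniformSpace.Completion.coe_sub, ← norm_eq_zero, UniformSpace.Completion.norm_coe]
    have h := tendsto_nhds_unique (tendsto_norm_sq (preRep U (ρ (f j)) ξ - f j p • ξ))
      (((hlim j).mono_left hU').norm.pow 2)
    simpa using h

end Eigenvectors

/-! ### Lifting the semigroup -/

section Lift

variable {H : Type*} [NormedAddCommGroup H] [InnerProductSpace ℂ H] [CompleteSpace H]

theorem C0Semigroup.exists_norm_le {E : Type*} [NormedAddCommGroup E] [NormedSpace ℂ E]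
    [CompleteSpace E] (T : C0Semigroup E) (N : ℝ≥0) : ∃ M : ℝ, ∀ t ≤ N, ‖T t‖ ≤ M := by
  obtain ⟨M, hM⟩ := banach_steinhaus (g := fun t : Set.Iic N => T t) fun x => by
    have hc : IsCompact (Set.Iic N) := by
      rw [← Set.Icc_bot]
      exact isCompact_Icc
    obtain ⟨C, hC⟩ := (hc.image (T.continuous_apply x).norm).bddAbove
    exact ⟨C, fun t => hC ⟨t, t.2, rfl⟩⟩
  exact ⟨M, fun t ht => hM ⟨t, ht⟩⟩

/-- If the Busby invariant is `π(W)⋆ (π ∘ σ) π(W)`, then `g ↦ W⋆ (σ g) W` is a splitting. -/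
theorem Extension.IsZero.exists_isSplitting {X : Type*} [TopologicalSpace X]
    {Γ : Extension H X} (hΓ : Γ.IsZero) : ∃ ρ : C(X, ℂ) →⋆ₐ[ℂ] Γ.algebra, Γ.IsSplitting ρ := by
  obtain ⟨σ, -, W, hW, hσ⟩ := hΓ
  have hWW : W * star W = 1 := Unitary.mul_star_self_of_mem hW
  have hWW' : star W * W = 1 := Unitary.star_mul_self_of_mem hW
  let ρ : C(X, ℂ) →⋆ₐ[ℂ] (H →L[ℂ] H) :=
    { toFun := fun g => star W * σ g * W
      map_one' := by rw [map_one, mul_one, hWW']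
      map_mul' := fun f g => by
        calc star W * σ (f * g) * W = star W * σ f * 1 * σ g * W := by
              rw [map_mul, mul_one]; noncomm_ring
          _ = _ := by rw [← hWW]; noncomm_ring
      map_zero' := by simp
      map_add' := fun f g => by rw [map_add, mul_add, add_mul]
      commutes' := fun c => by
        rw [AlgHomClass.commutes, ← Algebra.commutes, mul_assoc, hWW', mul_one]
      map_star' := fun f => by simp only [map_star, star_mul, star_star, mul_assoc] }
  have hρ : ∀ g, Calkin.mk H (ρ g) = Calkin.mk H (Γ.lift g) := fun g => by
    refine Eq.trans ?_ (hσ g).symm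
    change Calkin.mk H (star W * σ g * W) = _
    rw [map_mul, map_mul, map_star]
    rfl
  have hmem : ∀ g, ρ g ∈ Γ.algebra := fun g => by
    have hc : IsCompactOperator (ρ g - Γ.lift g : H →L[ℂ] H) := by
      rw [← Calkin.mk_eq_zero_iff, map_sub, hρ, sub_self]
    have := add_mem (Γ.mem_of_isCompactOperator _ hc) (Γ.lift g).2
    rwa [sub_add_cancel] at this
  refine ⟨ρ.codRestrict Γ.algebra hmem, fun g => ?_⟩
  refine Eq.trans ?_ (Γ.hom_lift g)
  rw [← sub_eq_zero, ← map_sub, Γ.hom_eq_zero_iff]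
  change IsCompactOperator (ρ g - Γ.lift g : H →L[ℂ] H)
  rw [← Calkin.mk_eq_zero_iff, map_sub, hρ, sub_self]

namespace DyadicSemigroup

variable {q : DyadicSemigroup (Calkin H)}

theorem gelfand_add (s t : PosDyadic) : q.gelfand (s + t) = q.gelfand s * q.gelfand t := by
  rw [gelfand, gelfand, gelfand, ← map_mul]
  exact congrArg _ (Subtype.ext (q.map_add s t))

theorem IsNormal.mk_splitting_gelfand (hq : q.IsNormal)
    {ρ : C(q.Delta, ℂ) →⋆ₐ[ℂ] hq.extension.algebra} (hρ : hq.extension.IsSplitting ρ)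
    (t : PosDyadic) : Calkin.mk H (ρ (q.gelfand t) : H →L[ℂ] H) = q t := by
  have h := hρ (q.gelfand t)
  rw [hq.extension_hom] at h
  exact congrArg Subtype.val (hq.gelfandEquiv.injective h)

/-- Every point of the maximal ideal space is the joint eigenvalue of a unit vector for the
semigroup in the Calkin representation. -/
theorem IsNormal.exists_eigenvector (hq : q.IsNormal)
    {ρ : C(q.Delta, ℂ) →⋆ₐ[ℂ] hq.extension.algebra} (hρ : hq.extension.IsSplitting ρ)
    {U : Ultrafilter ℕ} (hU : (U : Filter ℕ) ≤ cofinite) (p : q.Delta) :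
    ∃ ξ : CalkinSpace H U, ‖ξ‖ = 1 ∧ ∀ t, calkinRep H hU (q t) ξ = q.gelfand t p • ξ := by
  obtain ⟨ξ, hξ, h⟩ := CalkinLift.exists_eigenvector hU (hq.extension.algebra.subtype.comp ρ)
    (fun g hg => by rw [← hρ g]; exact (hq.extension.hom_eq_zero_iff _).2 hg)
    (fun n => q.gelfand (PosDyadic.twoPowNeg n)) p
  have h' : ∀ n, calkinRep H hU (q (PosDyadic.twoPowNeg n)) ξ
      = q.gelfand (PosDyadic.twoPowNeg n) p • ξ := fun n => by
    rw [← h n, ← hq.mk_splitting_gelfand hρ]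
    rfl
  refine ⟨ξ, hξ, fun t => ?_⟩
  obtain ⟨n, k, hk⟩ := q.exists_eq_pow t
  have hg : q.gelfand t p = q.gelfand (PosDyadic.twoPowNeg n) p ^ k := by
    change p ⟨q t, _⟩ = p ⟨q (PosDyadic.twoPowNeg n), _⟩ ^ k
    rw [← map_pow]
    exact congrArg p (Subtype.ext hk)
  rw [hg, hk, map_pow]
  have hn := h' n
  generalize q.gelfand (PosDyadic.twoPowNeg n) p = c at hn ⊢
  clear hg hk
  induction k with
  | zero => simp
  | succ k ih => rw [pow_succ, mul_apply_eq_comp, hn, map_smul, ih, smul_smul, pow_succ, mul_comm]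

/-- The image of a normal semigroup under a splitting is a lift which extends to a `C₀`-semigroup.
Strong continuity at `0` holds because `gelfand t → 1` boundedly and pointwise on `Δ`. -/
theorem IsNormal.exists_lift (hq : q.IsNormal)
    {ρ : C(q.Delta, ℂ) →⋆ₐ[ℂ] hq.extension.algebra} (hρ : hq.extension.IsSplitting ρ)
    {U : Ultrafilter ℕ} (hU : (U : Filter ℕ) ≤ cofinite)
    (hC0 : (q.map (calkinRep H hU)).ExtendsToC0) :
    ∃ Q : DyadicSemigroup (H →L[ℂ] H), (∀ t, Q t = (ρ (q.gelfand t) : H →L[ℂ] H)) ∧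
      (∀ t, Calkin.mk H (Q t) = q t) ∧ Q.IsSOTContinuous ∧ Q.ExtendsToC0 := by
  let ρ' : C(q.Delta, ℂ) →⋆ₐ[ℂ] (H →L[ℂ] H) := hq.extension.algebra.subtype.comp ρ
  let Q : DyadicSemigroup (H →L[ℂ] H) :=
    { toFun := fun t => (ρ (q.gelfand t) : H →L[ℂ] H)
      map_add := fun s t => by
        rw [gelfand_add, map_mul]
        rfl }
  obtain ⟨T, hT⟩ := hC0
  choose ξ hξ hTξ using fun p => hq.exists_eigenvector hρ hU p
  have hT' : ∀ t p, T t.val (ξ p) = q.gelfand t p • ξ p := fun t p => by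
    rw [hT]
    exact hTξ p t
  -- evaluation at eigenvectors transfers the bounds and the continuity of `T` to `gelfand t p`
  have hle : ∀ t p, ‖q.gelfand t p‖ ≤ ‖T t.val‖ := fun t p => by
    have h := (T t.val).le_opNorm (ξ p)
    rwa [hT', norm_smul, hξ, mul_one, mul_one] at h
  have hb : ∀ N : ℝ≥0, ∃ M : ℝ, ∀ t : PosDyadic, t.val ≤ N → ‖Q t‖ ≤ M := fun N => by
    obtain ⟨M, hM⟩ := T.exists_norm_le N
    exact ⟨M, fun t ht => norm_rep_le ρ'
      ((norm_nonneg _).trans (hM _ ht)) fun p => (hle t p).trans (hM _ ht)⟩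
  have h1 : ∀ p, Tendsto (fun t => q.gelfand t p - 1) (comap PosDyadic.val (𝓝 0))
      (𝓝 0) := fun p => by
    have h := ((T.continuous_apply (ξ p)).tendsto 0).comp
      (tendsto_comap (f := PosDyadic.val))
    rw [T.map_zero, one_apply_eq_self, tendsto_iff_norm_sub_tendsto_zero] at h
    refine tendsto_zero_iff_norm_tendsto_zero.2 (h.congr fun t => ?_)
    rw [Function.comp_apply, hT', ← mul_one ‖q.gelfand t p - 1‖, ← hξ p, ← norm_smul, sub_smul,
      one_smul]
  have h0 : ∀ x, Tendsto (fun t => Q t x) (comap PosDyadic.val (𝓝 0)) (𝓝 x) :=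
    fun x => by
    obtain ⟨M, hM⟩ := T.exists_norm_le 1
    have hbd : ∀ᶠ t in comap PosDyadic.val (𝓝 0), ∀ p, ‖(q.gelfand t - 1) p‖ ≤ M + 1 := by
      filter_upwards [preimage_mem_comap (Iic_mem_nhds (zero_lt_one (α := ℝ≥0)))] with t ht p
      refine (norm_sub_le _ _).trans (add_le_add ((hle t p).trans (hM _ ht)) ?_)
      simp
    refine tendsto_sub_nhds_zero_iff.1 ((tendsto_rep_apply_zero ρ' hbd h1 x).congr fun t => ?_)
    rw [map_sub, map_one]
    rfl
  exact ⟨Q, fun _ => rfl, hq.mk_splitting_gelfand hρ, Q.isSOTContinuous_of_tendsto hb h0,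
    Q.extendsToC0_of_tendsto hb h0⟩

end DyadicSemigroup

end Lift

end CalkinLift

theorem theorem4p4 {H : Type*} [NormedAddCommGroup H] [InnerProductSpace ℂ H] [CompleteSpace H]
    [TopologicalSpace.SeparableSpace H] (hH : ¬ FiniteDimensional ℂ H)
    (U : Ultrafilter ℕ) (hU : (U : Filter ℕ) ≤ Filter.cofinite)
    (q : CalkinLift.DyadicSemigroup (CalkinLift.Calkin H)) (hq : q.IsNormal)
    (hC0 : (q.map (CalkinLift.calkinRep H hU)).ExtendsToC0)
    (hΘ : hq.extension.IsZero)
    (hΔ : ∀ p : q.Delta, ¬ IsOpen ({p} : Set q.Delta)) :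
    (∃ ρ : C(q.Delta, ℂ) →⋆ₐ[ℂ] hq.extension.algebra, hq.extension.IsSplitting ρ) ∧
    ∀ ρ : C(q.Delta, ℂ) →⋆ₐ[ℂ] hq.extension.algebra, hq.extension.IsSplitting ρ →
      ∃ Q : CalkinLift.DyadicSemigroup (H →L[ℂ] H),
        (∀ t, Q t = (ρ (q.gelfand t) : H →L[ℂ] H)) ∧
        (∀ t, CalkinLift.Calkin.mk H (Q t) = q t) ∧
        Q.IsSOTContinuous ∧ Q.ExtendsToC0 := by
  exact ⟨hΘ.exists_isSplitting, fun ρ hρ => hq.exists_lift hρ hU hC0⟩
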